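/- Let $K$ be a non-empty closed convex subset of $\mathbf{R}^d$, let $\Omega=\mathbf{R}^d\setminus K$, and let $d_\Gamma(x)=\inf_{y\in K}|x-y|$, $x\in\Omega$, denote the Euclidean distance to the boundary $\Gamma=\partial\Omega$. Then $d_\Gamma$ is convex on every open convex subset of $\Omega$. Moreover, for almost every $x\in\Omega$ (with respect to Lebesgue measure) the function $d_\Gamma$ is twice differentiable at $x$, i.e. it is differentiable in a neighbourhood of $x$ and its derivative is differentiable at $x$, and the Hessian matrix $\big((\partial_k\partial_l d_\Gamma)(x)\big)_{k,l=1}^d$ is symmetric and positive semidefinite. -/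

import Mathlib

open MeasureTheory Filter Topology

namespace BoundaryDistance

/-- Euclidean distance to the boundary of `Ω`, given for `x ∈ Ω` by
`d_Γ(x) = inf_{y ∈ Ωᶜ} |x - y|`. -/
noncomputable def boundaryDist {n : ℕ} (Ω : Set (EuclideanSpace ℝ (Fin n)))
    (x : EuclideanSpace ℝ (Fin n)) : ℝ :=
  Metric.infDist x Ωᶜ

/-- Twice differentiable at `x`: `f` is (Fréchet) differentiable in a neighbourhood of `x`, and
its derivative is (Fréchet) differentiable at `x`. -/
def TwiceDifferentiableAt {n : ℕ} (f : EuclideanSpace ℝ (Fin n) → ℝ)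
    (x : EuclideanSpace ℝ (Fin n)) : Prop :=
  (∀ᶠ y in 𝓝 x, DifferentiableAt ℝ f y) ∧ DifferentiableAt ℝ (fderiv ℝ f) x

/-- The partial derivative `(∂_k f)(x)`. -/
noncomputable def partialDeriv {n : ℕ} (k : Fin n) (f : EuclideanSpace ℝ (Fin n) → ℝ)
    (x : EuclideanSpace ℝ (Fin n)) : ℝ :=
  lineDeriv ℝ f x (EuclideanSpace.single k 1)

/-- The Hessian matrix `((∂_k ∂_l f)(x))_{k,l}`. -/
noncomputable def hessian {n : ℕ} (f : EuclideanSpace ℝ (Fin n) → ℝ)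
    (x : EuclideanSpace ℝ (Fin n)) : Matrix (Fin n) (Fin n) ℝ :=
  Matrix.of fun k l => partialDeriv k (partialDeriv l f) x

end BoundaryDistance

open Metric
open scoped RealInnerProductSpace

section InnerProductSpace

variable {E : Type*} [NormedAddCommGroup E] [InnerProductSpace ℝ E]

/-! The distance to a convex set is convex on the whole space. Off `K` its gradient is `(x - P x) /
infDist x K`, where the nearest point map `P` is 1-Lipschitz. By Rademacher's theorem `P` is
differentiable almost everywhere, and at each such point off `K` so is the gradient. Symmetry of the
Hessian is then automatic, and convexity along lines makes it positive semidefinite. -/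

theorem Convex.convexOn_infDist {E : Type*} [SeminormedAddCommGroup E] [NormedSpace ℝ E]
    {K : Set E} (hK : Convex ℝ K) (hne : K.Nonempty) :
    ConvexOn ℝ Set.univ (fun x => infDist x K) := by
  refine ⟨convex_univ, fun x _ y _ a b ha hb hab => le_of_forall_pos_le_add fun ε hε => ?_⟩
  obtain ⟨p, hp, hxp⟩ := (infDist_lt_iff (x := x) hne).1 (lt_add_of_pos_right _ hε)
  obtain ⟨q, hq, hyq⟩ := (infDist_lt_iff (x := y) hne).1 (lt_add_of_pos_right _ hε)
  calc infDist (a • x + b • y) K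
      ≤ dist (a • x + b • y) (a • p + b • q) := infDist_le_dist_of_mem (hK hp hq ha hb hab)
    _ ≤ dist (a • x) (a • p) + dist (b • y) (b • q) := dist_add_add_le _ _ _ _
    _ = a * dist x p + b * dist y q := by
      rw [dist_smul₀, dist_smul₀, Real.norm_of_nonneg ha, Real.norm_of_nonneg hb]
    _ ≤ a * (infDist x K + ε) + b * (infDist y K + ε) := by gcongr
    _ = a • infDist x K + b • infDist y K + ε := by
      simp only [smul_eq_mul]; linear_combination ε * hab

/-- The second derivative of a convex function is nonnegative on the diagonal. -/
theorem ConvexOn.second_fderiv_apply_nonneg {E : Type*} [NormedAddCommGroup E] [NormedSpace ℝ E]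
    {f : E → ℝ} {f' : E → E →L[ℝ] ℝ} {f'' : E →L[ℝ] E →L[ℝ] ℝ}
    {x : E} (hf : ConvexOn ℝ Set.univ f) (hf' : ∀ᶠ y in 𝓝 x, HasFDerivAt f (f' y) y)
    (hf'' : HasFDerivAt f' f'' x) (v : E) : 0 ≤ f'' v v := by
  have hline (t : ℝ) : HasDerivAt (fun t : ℝ => x + t • v) v t := by
    simpa using ((hasDerivAt_id t).smul_const v).const_add x
  have hconv : ConvexOn ℝ Set.univ (fun t : ℝ => f (x + t • v)) := by
    refine ⟨convex_univ, fun s _ t _ a b ha hb hab => ?_⟩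
    have := hf.2 (Set.mem_univ (x + s • v)) (Set.mem_univ (x + t • v)) ha hb hab
    convert this using 2
    rw [← one_smul ℝ x, ← hab]
    simp only [smul_eq_mul]
    match_scalars <;> simp [hab]
  have hderiv {t : ℝ} (ht : HasFDerivAt f (f' (x + t • v)) (x + t • v)) :
      HasDerivAt (fun t : ℝ => f (x + t • v)) (f' (x + t • v) v) t :=
    ht.comp_hasDerivAt t (hline t)
  have hev : ∀ᶠ t : ℝ in 𝓝 0, HasFDerivAt f (f' (x + t • v)) (x + t • v) :=
    (show Tendsto (fun t : ℝ => x + t • v) (𝓝 0) (𝓝 x) by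
      simpa using (hline 0).continuousAt.tendsto).eventually hf'
  have hsecond : HasDerivAt (fun t : ℝ => f' (x + t • v) v) (f'' v v) 0 := by
    have h : HasFDerivAt f' f'' (x + (0 : ℝ) • v) := by simpa using hf''
    have hcomp : HasDerivAt (fun t : ℝ => f' (x + t • v)) (f'' v) 0 :=
      h.comp_hasDerivAt (0 : ℝ) (hline 0)
    exact (ContinuousLinearMap.apply ℝ ℝ v).hasFDerivAt.comp_hasDerivAt (0 : ℝ) hcomp
  have hslope := hsecond.tendsto_slope.mono_left (nhdsGT_le_nhdsNE (0 : ℝ))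
  refine ge_of_tendsto hslope ?_
  filter_upwards [nhdsWithin_le_nhds hev, self_mem_nhdsWithin] with t ht ht0
  have h0 : HasFDerivAt f (f' (x + (0 : ℝ) • v)) (x + (0 : ℝ) • v) := hev.self_of_nhds
  -- The secant slope over `[0, t]` lies between the derivatives at its endpoints.
  have hle := (hconv.le_slope_of_hasDerivAt (Set.mem_univ 0) (Set.mem_univ t) ht0
    (hderiv h0)).trans (hconv.slope_le_of_hasDerivAt (Set.mem_univ 0) (Set.mem_univ t) ht0
    (hderiv ht))
  rw [slope_def_field]
  exact div_nonneg (sub_nonneg.2 hle) (sub_nonneg.2 (le_of_lt ht0))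

/-- `P` selects a nearest point of `K`. -/
def IsNearestPointMap {E : Type*} [PseudoMetricSpace E] (K : Set E) (P : E → E) : Prop :=
  ∀ x, P x ∈ K ∧ infDist x K = dist x (P x)

namespace IsNearestPointMap

variable {K : Set E} {P : E → E}

theorem inner_le_zero (hP : IsNearestPointMap K P) (hK : Convex ℝ K) (x : E) {w : E} (hw : w ∈ K) :
    ⟪x - P x, w - P x⟫ ≤ 0 := by
  refine (norm_eq_iInf_iff_real_inner_le_zero hK (hP x).1).1 ?_ w hw
  simpa only [infDist_eq_iInf, dist_eq_norm] using (hP x).2.symm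

theorem lipschitzWith (hP : IsNearestPointMap K P) (hK : Convex ℝ K) : LipschitzWith 1 P := by
  refine LipschitzWith.of_dist_le_mul fun x y => ?_
  have h₁ := hP.inner_le_zero hK x (hP y).1
  have h₂ := hP.inner_le_zero hK y (hP x).1
  -- Firm nonexpansiveness: the sum of the two variational inequalities.
  have hsq : ‖P x - P y‖ ^ 2 ≤ ⟪x - y, P x - P y⟫ := by
    have : ⟪x - y, P x - P y⟫ - ⟪P x - P y, P x - P y⟫
        = -⟪x - P x, P y - P x⟫ - ⟪y - P y, P x - P y⟫ := by
      simp only [inner_sub_left, inner_sub_right]; ring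
    rw [real_inner_self_eq_norm_sq] at this
    linarith
  rw [NNReal.coe_one, one_mul, dist_eq_norm, dist_eq_norm]
  rcases (norm_nonneg (P x - P y)).eq_or_lt with h | h
  · rw [← h]; positivity
  · refine le_of_mul_le_mul_right ?_ h
    rw [← sq]
    exact hsq.trans (real_inner_le_norm _ _)

/-- Testing `P x` as a competitor at `x + h` bounds the increment above, and `P (x + h)` at `x`
bounds it below; the Lipschitz bound on `P` makes the error at most `‖h‖ ^ 2`. -/
theorem hasFDerivAt_infDist_sq (hP : IsNearestPointMap K P) (hK : Convex ℝ K) (x : E) :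
    HasFDerivAt (fun y => infDist y K ^ 2) ((2 : ℝ) • innerSL ℝ (x - P x)) x := by
  rw [hasFDerivAt_iff_isLittleO_nhds_zero]
  have hbound (h : E) : ‖infDist (x + h) K ^ 2 - infDist x K ^ 2
      - ((2 : ℝ) • innerSL ℝ (x - P x)) h‖ ≤ 1 * ‖‖h‖ ^ 2‖ := by
    have hsq (y w : E) (hw : w ∈ K) : infDist y K ^ 2 ≤ ‖y - w‖ ^ 2 := by
      rw [← dist_eq_norm]
      exact pow_le_pow_left₀ infDist_nonneg (infDist_le_dist_of_mem hw) 2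
    have heq (y : E) : infDist y K ^ 2 = ‖y - P y‖ ^ 2 := by rw [(hP y).2, dist_eq_norm]
    have hupper := hsq (x + h) (P x) (hP x).1
    have hlower := hsq x (P (x + h)) (hP (x + h)).1
    rw [show x + h - P x = (x - P x) + h by abel, norm_add_sq_real, ← heq x] at hupper
    rw [show x - P (x + h) = (x + h - P (x + h)) - h by abel, norm_sub_sq_real,
      ← heq (x + h)] at hlower
    have hlip : ⟪P (x + h) - P x, h⟫ ≤ ‖h‖ ^ 2 := by
      refine (real_inner_le_norm _ _).trans ?_
      rw [sq]
      gcongr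
      simpa [dist_eq_norm] using (hP.lipschitzWith hK).dist_le_mul (x + h) x
    have hsplit : ⟪x + h - P (x + h), h⟫ = ⟪x - P x, h⟫ + ‖h‖ ^ 2 - ⟪P (x + h) - P x, h⟫ := by
      rw [← real_inner_self_eq_norm_sq]
      simp only [inner_sub_left, inner_add_left]; ring
    simp only [smul_apply, innerSL_apply_apply, smul_eq_mul, one_mul, norm_pow,
      norm_norm]
    rw [Real.norm_eq_abs]
    rw [abs_le]
    constructor <;> linarith
  exact (Asymptotics.IsBigO.of_bound 1 (Eventually.of_forall hbound)).trans_isLittleO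
    (by simpa using Asymptotics.isLittleO_norm_pow_id (E' := E) one_lt_two)

theorem hasFDerivAt_infDist (hP : IsNearestPointMap K P) (hK : Convex ℝ K) {x : E}
    (hx : infDist x K ≠ 0) :
    HasFDerivAt (fun y => infDist y K) ((infDist x K)⁻¹ • innerSL ℝ (x - P x)) x := by
  have h := (hP.hasFDerivAt_infDist_sq hK x).sqrt (pow_ne_zero 2 hx)
  simp only [Real.sqrt_sq infDist_nonneg] at h
  convert h using 1
  rw [smul_smul]
  congr 1
  field_simp

theorem differentiableAt_smul_innerSL (hP : IsNearestPointMap K P) (hK : Convex ℝ K) {x : E}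
    (hx : infDist x K ≠ 0) (hPx : DifferentiableAt ℝ P x) :
    DifferentiableAt ℝ (fun y => (infDist y K)⁻¹ • innerSL ℝ (y - P y)) x :=
  ((hP.hasFDerivAt_infDist hK hx).differentiableAt.inv hx).smul
    ((innerSL ℝ).differentiableAt.comp x (differentiableAt_id.sub hPx))

end IsNearestPointMap

theorem IsClosed.exists_isNearestPointMap {E : Type*} [PseudoMetricSpace E] [ProperSpace E]
    {K : Set E} (hK : IsClosed K) (hne : K.Nonempty) : ∃ P : E → E, IsNearestPointMap K P := by
  choose P hPK hP using hK.exists_infDist_eq_dist hne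
  exact ⟨P, fun x => ⟨hPK x, hP x⟩⟩

end InnerProductSpace

namespace BoundaryDistance

variable {n : ℕ} {f : EuclideanSpace ℝ (Fin n) → ℝ} {x : EuclideanSpace ℝ (Fin n)}

theorem TwiceDifferentiableAt.hessian_apply (hf : TwiceDifferentiableAt f x) (k l : Fin n) :
    hessian f x k l = fderiv ℝ (fderiv ℝ f) x (EuclideanSpace.single k 1)
      (EuclideanSpace.single l 1) := by
  have heq : partialDeriv l f =ᶠ[𝓝 x] fun y => fderiv ℝ f y (EuclideanSpace.single l 1) :=
    hf.1.mono fun y hy => hy.lineDeriv_eq_fderiv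
  have hderiv := (hf.2.hasFDerivAt.clm_apply
    (hasFDerivAt_const (EuclideanSpace.single l (1 : ℝ)) x)).congr_of_eventuallyEq heq
  simpa [hessian, partialDeriv] using (hderiv.hasLineDerivAt (EuclideanSpace.single k 1)).lineDeriv

theorem TwiceDifferentiableAt.hessian_isHermitian (hf : TwiceDifferentiableAt f x) :
    (hessian f x).IsHermitian := by
  ext k l
  rw [Matrix.conjTranspose_apply, star_trivial, hf.hessian_apply, hf.hessian_apply]
  exact second_derivative_symmetric_of_eventually (hf.1.mono fun y hy => hy.hasFDerivAt)
    hf.2.hasFDerivAt _ _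

theorem TwiceDifferentiableAt.hessian_posSemidef (hf : TwiceDifferentiableAt f x)
    (hconv : ConvexOn ℝ Set.univ f) : (hessian f x).PosSemidef := by
  rw [Matrix.posSemidef_iff_dotProduct_mulVec]
  refine ⟨hf.hessian_isHermitian, fun v => ?_⟩
  have h := hconv.second_fderiv_apply_nonneg (hf.1.mono fun y hy => hy.hasFDerivAt)
    hf.2.hasFDerivAt (∑ k, v k • EuclideanSpace.single k 1)
  simp only [map_sum, map_smul, sum_apply, smul_apply,
    smul_eq_mul, ← hf.hessian_apply] at h
  simp only [dotProduct, Matrix.mulVec, star_trivial, Finset.mul_sum] at h ⊢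
  rw [Finset.sum_comm] at h
  refine h.trans_eq (Finset.sum_congr rfl fun k _ => Finset.sum_congr rfl fun l _ => ?_)
  ring

theorem twiceDifferentiableAt_infDist {K : Set (EuclideanSpace ℝ (Fin n))}
    {P : EuclideanSpace ℝ (Fin n) → EuclideanSpace ℝ (Fin n)} (hP : IsNearestPointMap K P)
    (hK : Convex ℝ K) (hx : infDist x K ≠ 0) (hPx : DifferentiableAt ℝ P x) :
    TwiceDifferentiableAt (fun y => infDist y K) x := by
  have hev : ∀ᶠ y in 𝓝 x, infDist y K ≠ 0 :=
    (continuous_infDist_pt K).continuousAt.eventually_ne hx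
  refine ⟨hev.mono fun y hy => (hP.hasFDerivAt_infDist hK hy).differentiableAt, ?_⟩
  -- The gradient formula holds near `x`, so it may be differentiated at `x`.
  exact (hP.differentiableAt_smul_innerSL hK hx hPx).congr_of_eventuallyEq
    (hev.mono fun y hy => (hP.hasFDerivAt_infDist hK hy).fderiv)

end BoundaryDistance

theorem proposition2p1 (n : ℕ) (K Ω : Set (EuclideanSpace ℝ (Fin n)))
    (hKclosed : IsClosed K) (hKconvex : Convex ℝ K) (hKne : K.Nonempty) (hΩ : Ω = Kᶜ) :
    (∀ U : Set (EuclideanSpace ℝ (Fin n)), IsOpen U → Convex ℝ U → U ⊆ Ω →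
      ConvexOn ℝ U (BoundaryDistance.boundaryDist Ω)) ∧
    (∀ᵐ x ∂(volume : Measure (EuclideanSpace ℝ (Fin n))), x ∈ Ω →
      BoundaryDistance.TwiceDifferentiableAt (BoundaryDistance.boundaryDist Ω) x ∧
      (BoundaryDistance.hessian (BoundaryDistance.boundaryDist Ω) x).PosSemidef) := by
  have hdist : BoundaryDistance.boundaryDist Ω = fun x => infDist x K := by
    funext x
    rw [BoundaryDistance.boundaryDist, hΩ, compl_compl]
  have hconv := hKconvex.convexOn_infDist hKne
  rw [hdist]
  refine ⟨fun U _ hU _ => hconv.subset (Set.subset_univ U) hU, ?_⟩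
  obtain ⟨P, hP⟩ := hKclosed.exists_isNearestPointMap hKne
  filter_upwards [(hP.lipschitzWith hKconvex).ae_differentiableAt (μ := volume)] with x hPx hxΩ
  have hx : infDist x K ≠ 0 :=
    ((hKclosed.notMem_iff_infDist_pos hKne).1 (by simpa [hΩ] using hxΩ)).ne'
  have htwice := BoundaryDistance.twiceDifferentiableAt_infDist hP hKconvex hx hPx
  exact ⟨htwice, htwice.hessian_posSemidef hconv⟩
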